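/- Consider a finite game with players $1,\dots,n$, where player $i$ has a finite set $S_i$ of pure strategies and a payoff function $A_i : S_1\times\dots\times S_n\to\mathbb{R}$. Write $S_{-i}=\prod_{j\ne i}S_j$, and for $s\in S_i$ and $\hat s=(s_j)_{j\neq i}\in S_{-i}$ let $A_i[s,\hat s]$ be the payoff of player $i$ when $i$ plays $s$ and the others play $\hat s$. A mixed strategy of player $i$ is a vector $x^i\in\mathbb{R}^{S_i}$ with $x^i\ge 0$ and $\sum_{s\in S_i}x^i_s=1$. The expected payoff of player $i$ at $x=(x^1,\dots,x^n)$ is $\mathbb{E}[A_i[x]]=\sum_{(s_1,\dots,s_n)}A_i[s_1,\dots,s_n]\prod_{j=1}^n x^j_{s_j}$. A tuple $x=(x^1,\dots,x^n)$ of mixed strategies is a Nash equilibrium if, for every player $i$ and every mixed strategy $y^i$ of player $i$, replacing $x^i$ by $y^i$ and keeping the other $x^j$ does not increase the expected payoff of player $i$. Let MLP1 be the following optimization problem in the real variables $x^i_s$ ($1\le i\le n$, $s\in S_i$) and $p^i$ ($1\le i\le n$): $$\begin{aligned}\max_{x,p}\quad & \sum_{i=1}^n\ \sum_{(s,\hat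 s)\in S_i\times S_{-i}}A_i[s,\hat s]\,x^i_s\prod_{j\ne i}x^j_{s_j}\;-\;\sum_{i=1}^n p^i\\ \text{s.t.}\quad & \sum_{\hat s\in S_{-i}}A_i[s,\hat s]\prod_{j\neq i}x^j_{s_j}\le p^i && \text{for all } i \text{ and all } s\in S_i,\\ & \sum_{s\in S_i}x^i_s=1 && \text{for all } i,\\ & 0\le x^i_s\le 1 && \text{for all } i \text{ and all } s\in S_i.\end{aligned}$$ **Theorem.** A tuple $x=(x^1,\dots,x^n)$ with $x^i\in\mathbb{R}^{S_i}$ is a Nash equilibrium of the game if and only if there exist real numbers $p^1,\dots,p^n$ such that $(x^1,\dots,x^n,p^1,\dots,p^n)$ is a globally optimal solution of MLP1. -/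

import Mathlib

noncomputable section

namespace FiniteGame

/-- The expected payoff `E[A_i[x]]` of player `i` when all players `j` independently play their
strategy `x j` (the probability of the pure strategy tuple `s` is `∏ j, x j (s j)`). -/
def expectedPayoff {n : ℕ} {S : Fin n → Type*} [∀ i, Fintype (S i)]
    (A : ∀ _ : Fin n, (∀ j, S j) → ℝ) (i : Fin n) (x : ∀ j, S j → ℝ) : ℝ :=
  ∑ s : ∀ j, S j, A i s * ∏ j, x j (s j)

/-- `x` is a (mixed) Nash equilibrium: every `x i` is a probability vector on the pure strategies
of player `i`, and no player gains by a unilateral deviation to another mixed strategy. -/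
def IsNashEquilibrium {n : ℕ} {S : Fin n → Type*} [∀ i, Fintype (S i)]
    (A : ∀ _ : Fin n, (∀ j, S j) → ℝ) (x : ∀ j, S j → ℝ) : Prop :=
  (∀ i, x i ∈ stdSimplex ℝ (S i)) ∧
    ∀ i, ∀ y ∈ stdSimplex ℝ (S i),
      expectedPayoff A i (Function.update x i y) ≤ expectedPayoff A i x

/-- Pure strategy tuples of all players except `i`. -/
abbrev Others {n : ℕ} (S : Fin n → Type*) (i : Fin n) : Type _ :=
  ∀ j : {j : Fin n // j ≠ i}, S j

/-- The entry `A_i[s, t]`: the payoff of player `i` when `i` plays `s` and the others play `t`. -/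
def payoffAt {n : ℕ} {S : Fin n → Type*}
    (A : ∀ _ : Fin n, (∀ j, S j) → ℝ) (i : Fin n) (s : S i) (t : Others S i) : ℝ :=
  A i ((Equiv.piSplitAt i S).symm (s, t))

/-- Objective function of the multilinear program `MLP1` at the point `(x, p)`. -/
def mlpObjective {n : ℕ} {S : Fin n → Type*} [∀ i, Fintype (S i)]
    (A : ∀ _ : Fin n, (∀ j, S j) → ℝ) (x : ∀ j, S j → ℝ) (p : Fin n → ℝ) : ℝ :=
  (∑ i, ∑ st : S i × Others S i,
    payoffAt A i st.1 st.2 * x i st.1 * ∏ j : {j : Fin n // j ≠ i}, x j (st.2 j)) - ∑ i, p i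

/-- The constraints of the multilinear program `MLP1`. -/
structure MLPFeasible {n : ℕ} {S : Fin n → Type*} [∀ i, Fintype (S i)]
    (A : ∀ _ : Fin n, (∀ j, S j) → ℝ) (x : ∀ j, S j → ℝ) (p : Fin n → ℝ) : Prop where
  payoff_le : ∀ (i : Fin n) (s : S i),
    ∑ t : Others S i, payoffAt A i s t * ∏ j : {j : Fin n // j ≠ i}, x j (t j) ≤ p i
  sum_eq_one : ∀ i, ∑ s, x i s = 1
  bounds : ∀ (i : Fin n) (s : S i), 0 ≤ x i s ∧ x i s ≤ 1

/-- `(x, p)` is a (globally) optimal solution of `MLP1`. -/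
def IsMLPOptimal {n : ℕ} {S : Fin n → Type*} [∀ i, Fintype (S i)]
    (A : ∀ _ : Fin n, (∀ j, S j) → ℝ) (x : ∀ j, S j → ℝ) (p : Fin n → ℝ) : Prop :=
  MLPFeasible A x p ∧
    ∀ (x' : ∀ j, S j → ℝ) (p' : Fin n → ℝ), MLPFeasible A x' p' →
      mlpObjective A x' p' ≤ mlpObjective A x p

end FiniteGame

end

/-! Averaging the constraints of MLP1 over `x i` gives `expectedPayoff A i x ≤ p i`, so the
objective is at most 0 at feasible points. It is 0 exactly when every `p i` is the expected payoff,
and the constraints then say that no pure deviation pays. An equilibrium therefore attains 0. The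
converse needs the maximum to be 0, which is Nash's existence theorem. Existence follows from a
variational inequality on the product of simplices, hence from Brouwer. Brouwer is derived from the
absence of a `C¹` retraction f of the ball onto its sphere: the volume integral of det(id + t(Df -
id)) is polynomial in t and constant for small t > 0, yet at t = 1 it would vanish. -/

/-! ### No `C¹` retraction of the ball onto the sphere -/

open Metric Set in
theorem det_id_add_pos_of_norm_lt_one {E : Type*} [NormedAddCommGroup E] [NormedSpace ℝ E]
    [FiniteDimensional ℝ E] (M : E →L[ℝ] E) (hM : ‖M‖ < 1) :
    0 < (ContinuousLinearMap.id ℝ E + M).det := by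
  -- A kernel vector would satisfy `‖v‖ ≤ ‖M‖ * ‖v‖`; hence the determinant keeps its sign from s =
  -- 0 to s = 1.
  have hne : ∀ s ∈ Icc (0 : ℝ) 1, (ContinuousLinearMap.id ℝ E + s • M).det ≠ 0 := by
    intro s hs h0
    obtain ⟨v, hv, hv0⟩ := (Submodule.ne_bot_iff _).1 (LinearMap.bot_lt_ker_of_det_eq_zero h0).ne'
    have hv1 : v + s • M v = 0 := by simpa using hv
    have hv2 : ‖v‖ ≤ ‖M‖ * ‖v‖ := calc
      ‖v‖ = ‖s • M v‖ := by
        rw [← norm_neg (s • M v), ← eq_neg_of_add_eq_zero_left hv1]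
      _ = s * ‖M v‖ := by rw [norm_smul, Real.norm_of_nonneg hs.1]
      _ ≤ 1 * ‖M v‖ := by gcongr; exact hs.2
      _ ≤ ‖M‖ * ‖v‖ := by rw [one_mul]; exact M.le_opNorm v
    nlinarith [norm_pos_iff.2 hv0]
  by_contra! h
  have hcont : ContinuousOn (fun s : ℝ => (ContinuousLinearMap.id ℝ E + s • M).det) (Icc 0 1) :=
    (ContinuousLinearMap.continuous_det.comp (by fun_prop)).continuousOn
  have := intermediate_value_Icc' zero_le_one hcont
  obtain ⟨s, hs, h0⟩ := this (show (0 : ℝ) ∈ _ by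
    constructor
    · simpa using h
    · simp [ContinuousLinearMap.det])
  exact hne s hs h0

theorem det_id_add_smul_eq_eval {E : Type*} [NormedAddCommGroup E] [NormedSpace ℝ E]
    [FiniteDimensional ℝ E] (M : E →L[ℝ] E) :
    ∃ P : Polynomial ℝ, P.natDegree ≤ Module.finrank ℝ E ∧
      ∀ t : ℝ, (ContinuousLinearMap.id ℝ E + t • M).det = P.eval t := by
  let b := Module.finBasis ℝ E
  let A := LinearMap.toMatrix b b (M : E →ₗ[ℝ] E)
  refine ⟨Matrix.det ((Polynomial.X : Polynomial ℝ) • A.map Polynomial.C +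
    (1 : Matrix _ _ ℝ).map Polynomial.C), ?_, fun t => ?_⟩
  · simpa using Polynomial.natDegree_det_X_add_C_le A 1
  · rw [ContinuousLinearMap.det, ← LinearMap.det_toMatrix b, ← Polynomial.coe_evalRingHom,
      RingHom.map_det]
    congr 1
    ext i j
    simp only [LinearMap.toMatrix_apply, A, Matrix.one_apply, RingHom.mapMatrix_apply,
      Matrix.map_apply, Matrix.add_apply, Matrix.smul_apply, Polynomial.coe_evalRingHom,
      Polynomial.eval_add, smul_eq_mul, Polynomial.eval_mul, Polynomial.eval_X, Polynomial.eval_C]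
    rcases eq_or_ne i j with rfl | hij
    · simp [add_comm]
    · simp [hij]

-- A segment leaving the ball crosses the sphere, where `g` vanishes, so extension by zero keeps the
-- Lipschitz constant.
open Metric Set in
theorem lipschitzWith_indicator_closedBall {E F : Type*} [NormedAddCommGroup E] [NormedSpace ℝ E]
    [NormedAddCommGroup F] {g : E → F} {L : NNReal}
    (hg : LipschitzOnWith L g (closedBall 0 1)) (h0 : ∀ x ∈ sphere (0 : E) 1, g x = 0) :
    LipschitzWith L ((closedBall (0 : E) 1).indicator g) := by
  classical
  have key : ∀ x ∈ closedBall (0 : E) 1, ∀ y ∉ closedBall (0 : E) 1, ‖g x‖ ≤ L * dist x y := by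
    intro x hx y hy
    have hc : ContinuousOn (fun t : ℝ => ‖AffineMap.lineMap x y t‖) (Icc 0 1) := by
      apply Continuous.continuousOn
      exact continuous_norm.comp AffineMap.lineMap_continuous
    obtain ⟨t, ht, h1⟩ := intermediate_value_Icc zero_le_one hc (show (1 : ℝ) ∈ _ by
      constructor
      · simpa using hx
      · simpa using (not_le.mp (by simpa using hy)).le)
    have hz : AffineMap.lineMap x y t ∈ sphere (0 : E) 1 := by simpa using h1
    have := hg.dist_le_mul x hx _ (sphere_subset_closedBall hz)
    rw [h0 _ hz, dist_zero_right, dist_left_lineMap] at this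
    refine this.trans ?_
    rw [Real.norm_of_nonneg ht.1]
    gcongr
    exact mul_le_of_le_one_left dist_nonneg ht.2
  refine LipschitzWith.of_dist_le_mul fun x y => ?_
  by_cases hx : x ∈ closedBall (0 : E) 1 <;> by_cases hy : y ∈ closedBall (0 : E) 1
  · rw [indicator_of_mem hx, indicator_of_mem hy]
    exact hg.dist_le_mul x hx y hy
  · rw [indicator_of_mem hx, indicator_of_notMem hy, dist_zero_right]
    exact key x hx y hy
  · rw [indicator_of_notMem hx, indicator_of_mem hy, dist_zero_left, dist_comm]
    exact key y hy x hx
  · rw [indicator_of_notMem hx, indicator_of_notMem hy, dist_self]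
    positivity

theorem bijective_id_add_of_lipschitzWith {E : Type*} [NormedAddCommGroup E] [NormedSpace ℝ E]
    [CompleteSpace E] {g : E → E} {c : NNReal} (hg : LipschitzWith c g) (hc : c < 1) :
    Function.Bijective fun x => x + g x := by
  rcases subsingleton_or_nontrivial E with hE | hE
  · exact ⟨fun x y _ => Subsingleton.elim _ _, fun y => ⟨y, Subsingleton.elim _ _⟩⟩
  have h : ApproximatesLinearOn (fun x => x + g x)
      ((ContinuousLinearEquiv.refl ℝ E : E ≃L[ℝ] E) : E →L[ℝ] E) Set.univ c := by
    rw [ApproximatesLinearOn.approximatesLinearOn_iff_lipschitzOnWith, lipschitzOnWith_univ]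
    convert hg using 1
    ext x
    simp
  have hc' : c < ‖((ContinuousLinearEquiv.refl ℝ E).symm : E →L[ℝ] E)‖₊⁻¹ := by
    have : ((ContinuousLinearEquiv.refl ℝ E).symm : E →L[ℝ] E) = ContinuousLinearMap.id ℝ E := rfl
    rw [this, ContinuousLinearMap.nnnorm_id]
    simpa using hc
  exact ⟨Set.injOn_univ.1 (h.injOn (Or.inr hc')), h.surjective (Or.inr hc')⟩

theorem Polynomial.eval_eq_sum_eval_mul_basis {n : ℕ} {v : ℕ → ℝ} (hv : Function.Injective v)
    {P : Polynomial ℝ} (hP : P.natDegree ≤ n) (t : ℝ) :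
    P.eval t = ∑ i ∈ Finset.range (n + 1),
      P.eval (v i) * (Lagrange.basis (Finset.range (n + 1)) v i).eval t := by
  have hd : P.degree < (Finset.range (n + 1)).card := by
    rw [Finset.card_range]
    exact (Polynomial.degree_le_of_natDegree_le hP).trans_lt (by exact_mod_cast Nat.lt_succ_self n)
  conv_lhs => rw [Lagrange.eq_interpolate hv.injOn hd]
  simp [Lagrange.interpolate_apply, Polynomial.eval_finsetSum]

-- Convexity keeps the image inside the ball. The extended map is the identity off the open ball, so
-- preimages of points of the ball lie in it.
open Metric Set in
theorem image_ball_id_add_smul {E : Type*} [NormedAddCommGroup E] [NormedSpace ℝ E]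
    {f : E → E} (hf : ∀ x ∈ closedBall (0 : E) 1, ‖f x‖ ≤ 1)
    {t : ℝ} (ht0 : 0 ≤ t) (ht1 : t < 1)
    (hbij : Function.Bijective fun x => x + t • (closedBall (0 : E) 1).indicator (fun x => f x - x) x)
    (hs : ∀ x ∈ sphere (0 : E) 1, f x = x) :
    (fun x => x + t • (f x - x)) '' ball 0 1 = ball 0 1 := by
  apply Subset.antisymm
  · rintro _ ⟨x, hx, rfl⟩
    have h1 := hf x (ball_subset_closedBall hx)
    rw [mem_ball_zero_iff] at hx ⊢
    calc ‖x + t • (f x - x)‖ = ‖(1 - t) • x + t • f x‖ := by congr 1; module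
      _ ≤ ‖(1 - t) • x‖ + ‖t • f x‖ := norm_add_le _ _
      _ = (1 - t) * ‖x‖ + t * ‖f x‖ := by
        rw [norm_smul, norm_smul, Real.norm_of_nonneg ht0, Real.norm_of_nonneg (by linarith)]
      _ < 1 := by nlinarith
  · intro y hy
    obtain ⟨x, hx⟩ := hbij.2 y
    have hxB : x ∈ ball (0 : E) 1 := by
      by_contra hxB
      have : y = x := by
        rw [← hx]
        by_cases hxs : x ∈ closedBall (0 : E) 1
        · have : x ∈ sphere (0 : E) 1 := by
            rw [mem_sphere]
            exact le_antisymm hxs (not_lt.1 hxB)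
          simp [indicator_of_mem hxs, hs x this]
        · simp [indicator_of_notMem hxs]
      exact hxB (this ▸ hy)
    refine ⟨x, hxB, ?_⟩
    rw [← hx]
    simp [indicator_of_mem (ball_subset_closedBall hxB)]

open Metric Set MeasureTheory in
theorem exists_setIntegral_det_id_add_smul_eq {E : Type*} [NormedAddCommGroup E] [NormedSpace ℝ E]
    [FiniteDimensional ℝ E] [MeasurableSpace E] [BorelSpace E] (μ : Measure E)
    [μ.IsAddHaarMeasure] {f : E → E} (hf : ∀ x ∈ closedBall (0 : E) 1, ContDiffAt ℝ 1 f x)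
    (hle : ∀ x ∈ closedBall (0 : E) 1, ‖f x‖ ≤ 1) (hs : ∀ x ∈ sphere (0 : E) 1, f x = x) :
    ∃ δ : ℝ, 0 < δ ∧ ∀ t : ℝ, 0 < t → t < δ →
      ∫ x in ball (0 : E) 1, (ContinuousLinearMap.id ℝ E +
        t • (fderiv ℝ f x - ContinuousLinearMap.id ℝ E)).det ∂μ = μ.real (ball (0 : E) 1) := by
  have hg : ContDiffOn ℝ 1 (fun x => f x - x) (closedBall (0 : E) 1) := fun x hx =>
    ((hf x hx).sub contDiffAt_id).contDiffWithinAt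
  obtain ⟨L, hL⟩ := hg.exists_lipschitzOnWith one_ne_zero (convex_closedBall 0 1)
    (isCompact_closedBall 0 1)
  have hL' := lipschitzWith_indicator_closedBall hL fun x hx => by simp [hs x hx]
  refine ⟨1 / (L + 1), by positivity, fun t ht0 ht1 => ?_⟩
  have htL : t * (L + 1) < 1 := by rwa [lt_div_iff₀ (by positivity)] at ht1
  have hL0 : (0 : ℝ) ≤ L := L.2
  have hLip : LipschitzWith (t.toNNReal * L)
      (fun x => t • (closedBall (0 : E) 1).indicator (fun x => f x - x) x) := by
    refine LipschitzWith.of_dist_le_mul fun x y => ?_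
    rw [dist_smul₀, Real.norm_of_nonneg ht0.le, NNReal.coe_mul,
      Real.coe_toNNReal _ ht0.le, mul_assoc]
    exact mul_le_mul_of_nonneg_left (hL'.dist_le_mul x y) ht0.le
  have hbij := bijective_id_add_of_lipschitzWith hLip (by
    rw [← NNReal.coe_lt_coe, NNReal.coe_mul, Real.coe_toNNReal _ ht0.le, NNReal.coe_one]; nlinarith)
  have himg := image_ball_id_add_smul hle ht0.le (by nlinarith [mul_nonneg ht0.le hL0]) hbij hs
  have hinj : InjOn (fun x => x + t • (f x - x)) (ball 0 1) := by
    refine (hbij.1.injOn (s := ball 0 1)).congr fun x hx => ?_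
    simp [indicator_of_mem (ball_subset_closedBall hx)]
  have hderiv : ∀ x ∈ ball (0 : E) 1, HasFDerivAt (fun x => f x - x)
      (fderiv ℝ f x - ContinuousLinearMap.id ℝ E) x := fun x hx =>
    ((hf x (ball_subset_closedBall hx)).differentiableAt one_ne_zero).hasFDerivAt.sub
      (hasFDerivAt_id x)
  have hnorm : ∀ x ∈ ball (0 : E) 1, ‖fderiv ℝ f x - ContinuousLinearMap.id ℝ E‖ ≤ L :=
    fun x hx => (hderiv x hx).le_of_lipschitzOn
      (isOpen_ball.mem_nhds hx) (hL.mono ball_subset_closedBall)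
  have hcv := integral_image_eq_integral_abs_det_fderiv_smul μ measurableSet_ball
    (fun x hx => ((hasFDerivAt_id x).add ((hderiv x hx).const_smul t)).hasFDerivWithinAt) hinj
    (fun _ => (1 : ℝ))
  have himg' : (id + t • fun x => f x - x) '' ball 0 1 = ball 0 1 := himg
  rw [himg', setIntegral_const, smul_eq_mul, mul_one] at hcv
  rw [hcv]
  refine setIntegral_congr_fun measurableSet_ball fun x hx => ?_
  have hpos := det_id_add_pos_of_norm_lt_one
    (t • (fderiv ℝ f x - ContinuousLinearMap.id ℝ E)) (by
      rw [norm_smul, Real.norm_of_nonneg ht0.le]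
      nlinarith [hnorm x hx])
  rw [smul_eq_mul, mul_one, abs_of_pos hpos]

open Metric Set MeasureTheory in
theorem exists_det_fderiv_ne_zero_of_eqOn_sphere {E : Type*} [NormedAddCommGroup E]
    [NormedSpace ℝ E] [FiniteDimensional ℝ E] {f : E → E}
    (hf : ∀ x ∈ closedBall (0 : E) 1, ContDiffAt ℝ 1 f x)
    (hle : ∀ x ∈ closedBall (0 : E) 1, ‖f x‖ ≤ 1) (hs : ∀ x ∈ sphere (0 : E) 1, f x = x) :
    ∃ x ∈ ball (0 : E) 1, (fderiv ℝ f x).det ≠ 0 := by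
  borelize E
  let μ : Measure E := Measure.addHaar
  by_contra! hdet
  obtain ⟨δ, hδ, hint⟩ := exists_setIntegral_det_id_add_smul_eq μ hf hle hs
  let q : E → ℝ → ℝ := fun x t => (ContinuousLinearMap.id ℝ E +
        t • (fderiv ℝ f x - ContinuousLinearMap.id ℝ E)).det
  have hq : ∀ t, IntegrableOn (q · t) (ball 0 1) μ := by
    intro t
    refine IntegrableOn.mono_set (t := closedBall 0 1) ?_ ball_subset_closedBall
    refine ContinuousOn.integrableOn_compact (isCompact_closedBall 0 1) fun x hx => ?_
    have : ContinuousAt (fderiv ℝ f) x :=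
      ((hf x hx).fderiv_right (m := 0) (by norm_num)).continuousAt
    exact (ContinuousLinearMap.continuous_det.continuousAt.comp
      (f := fun x => ContinuousLinearMap.id ℝ E +
        t • (fderiv ℝ f x - ContinuousLinearMap.id ℝ E)) (by fun_prop)).continuousWithinAt
  let n := Module.finrank ℝ E
  -- Distinct nodes strictly inside (0, δ); Lagrange interpolation there carries the volume identity
  -- to t = 1.
  let v : ℕ → ℝ := fun i => δ / (i + 2)
  have hv : Function.Injective v := by
    intro i j hij
    have : (i : ℝ) + 2 = j + 2 := by
      simp only [v] at hij
      field_simp at hij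
      linarith
    exact_mod_cast add_right_cancel this
  have hv0 : ∀ i, 0 < v i := fun i => by positivity
  have hvδ : ∀ i, v i < δ := fun i => by
    refine div_lt_self hδ ?_
    have : (0 : ℝ) ≤ i := i.cast_nonneg
    linarith
  let c : ℕ → ℝ := fun i => (Lagrange.basis (Finset.range (n + 1)) v i).eval 1
  have hc : ∑ i ∈ Finset.range (n + 1), c i = 1 := by
    have := Polynomial.eval_eq_sum_eval_mul_basis hv (P := 1) (n := n) (by simp) 1
    simpa using this.symm
  have hq1 : ∀ x, q x 1 = ∑ i ∈ Finset.range (n + 1), q x (v i) * c i := by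
    intro x
    obtain ⟨P, hP, hPq⟩ :=
      det_id_add_smul_eq_eval (fderiv ℝ f x - ContinuousLinearMap.id ℝ E)
    simp only [q, hPq]
    exact Polynomial.eval_eq_sum_eval_mul_basis hv hP 1
  have h1 : ∫ x in ball (0 : E) 1, q x 1 ∂μ = μ.real (ball (0 : E) 1) := by
    simp_rw [hq1]
    rw [integral_finsetSum _ fun i _ => (hq (v i)).mul_const (c i)]
    simp_rw [integral_mul_const]
    rw [Finset.sum_congr rfl fun i _ => congrArg (· * c i) (hint (v i) (hv0 i) (hvδ i)),
      ← Finset.mul_sum, hc, mul_one]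
  have h0 : ∫ x in ball (0 : E) 1, q x 1 ∂μ = 0 := by
    refine setIntegral_eq_zero_of_forall_eq_zero fun x hx => ?_
    simpa [q] using hdet x hx
  have hpos : 0 < μ.real (ball (0 : E) 1) :=
    ENNReal.toReal_pos (measure_ball_pos μ 0 one_pos).ne' measure_ball_lt_top.ne
  linarith

-- Differentiating `‖f‖ ^ 2 = 1` makes the range of the derivative orthogonal to the nonzero vector
-- `f x`.
open Metric Set in
theorem det_fderiv_eq_zero_of_norm_eq_one {E : Type*} [NormedAddCommGroup E]
    [InnerProductSpace ℝ E] [FiniteDimensional ℝ E] {f : E → E} {x : E}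
    (hf : DifferentiableAt ℝ f x) (h : ∀ᶠ y in nhds x, ‖f y‖ = 1) : (fderiv ℝ f x).det = 0 := by
  by_contra hdet
  have hzero : ∀ v, inner ℝ (f x) (fderiv ℝ f x v) = 0 := by
    intro v
    have h1 := hf.hasFDerivAt.norm_sq
    have h2 : HasFDerivAt (fun y => ‖f y‖ ^ 2) (0 : E →L[ℝ] ℝ) x :=
      (hasFDerivAt_const (1 : ℝ) x).congr_of_eventuallyEq (h.mono fun y hy => by simp [hy])
    have := congrArg (· v) (h1.unique h2)
    simpa using this
  have hsurj : Function.Surjective (fderiv ℝ f x) := by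
    exact ((Module.End.isUnit_iff _).1
      ((LinearMap.isUnit_iff_isUnit_det (fderiv ℝ f x : E →ₗ[ℝ] E)).2 (Ne.isUnit hdet))).2
  obtain ⟨v, hv⟩ := hsurj (f x)
  have := hzero v
  rw [hv, real_inner_self_eq_norm_sq, h.self_of_nhds] at this
  norm_num at this

open Metric Set in
/-- There is no `C¹` retraction of the closed unit ball onto the unit sphere. -/
theorem not_forall_norm_eq_one_of_eqOn_sphere {E : Type*} [NormedAddCommGroup E]
    [InnerProductSpace ℝ E] [FiniteDimensional ℝ E] {f : E → E}
    (hf : ∀ x ∈ closedBall (0 : E) 1, ContDiffAt ℝ 1 f x)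
    (hs : ∀ x ∈ sphere (0 : E) 1, f x = x) : ¬ ∀ x ∈ closedBall (0 : E) 1, ‖f x‖ = 1 := by
  intro h1
  obtain ⟨x, hx, hdet⟩ := exists_det_fderiv_ne_zero_of_eqOn_sphere hf (fun x hx => (h1 x hx).le) hs
  refine hdet (det_fderiv_eq_zero_of_norm_eq_one
    ((hf x (ball_subset_closedBall hx)).differentiableAt one_ne_zero) ?_)
  filter_upwards [isOpen_ball.mem_nhds hx] with y hy using h1 y (ball_subset_closedBall hy)

/-! ### Brouwer's fixed point theorem -/

open Metric Set in
theorem exists_fixedPoint_closedBall_of_contDiff {E : Type*} [NormedAddCommGroup E]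
    [InnerProductSpace ℝ E] [FiniteDimensional ℝ E] {F : E → E} (hF : ContDiff ℝ 1 F)
    (hle : ∀ x ∈ closedBall (0 : E) 1, ‖F x‖ ≤ 1) : ∃ x ∈ closedBall (0 : E) 1, F x = x := by
  by_contra! hne
  let a : E → ℝ := fun x => ‖x - F x‖ ^ 2
  let b : E → ℝ := fun x => inner ℝ x (x - F x)
  let d : E → ℝ := fun x => b x ^ 2 + a x * (1 - ‖x‖ ^ 2)
  -- The larger root of ‖x + s(x - F x)‖² = 1: the ray from `F x` through `x` meets the sphere
  -- there. Since `d > 0` it is `C¹`, and since `b > 0` on the sphere it is 0 there.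
  let s : E → ℝ := fun x => (-b x + √(d x)) / a x
  have ha : ∀ x ∈ closedBall (0 : E) 1, 0 < a x := fun x hx => by
    have := norm_pos_iff.2 (sub_ne_zero.2 (hne x hx).symm)
    positivity
  have hb : ∀ x ∈ sphere (0 : E) 1, 0 < b x := fun x hx => by
    have h1 := ha x (sphere_subset_closedBall hx)
    have h2 := hle x (sphere_subset_closedBall hx)
    rw [mem_sphere_zero_iff_norm] at hx
    simp only [a, b, norm_sub_sq_real, inner_sub_right, real_inner_self_eq_norm_sq, hx] at h1 ⊢
    nlinarith [norm_nonneg (F x)]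
  have hd : ∀ x ∈ closedBall (0 : E) 1, 0 < d x := fun x hx => by
    rcases (mem_closedBall_zero_iff.1 hx).lt_or_eq with h | h
    · have : 0 < 1 - ‖x‖ ^ 2 := by nlinarith [norm_nonneg x]
      have := ha x hx
      positivity
    · have := hb x (mem_sphere_zero_iff_norm.2 h)
      simp only [d, h]
      norm_num
      positivity
  refine not_forall_norm_eq_one_of_eqOn_sphere (f := fun x => x + s x • (x - F x)) ?_ ?_ ?_
  · intro x hx
    have hu : ContDiffAt ℝ 1 (fun x => x - F x) x := contDiffAt_id.sub hF.contDiffAt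
    have ha' : ContDiffAt ℝ 1 a x := hu.norm_sq ℝ
    have hb' : ContDiffAt ℝ 1 b x := contDiffAt_id.inner ℝ hu
    have hd' : ContDiffAt ℝ 1 d x :=
      (hb'.pow 2).add (ha'.mul (contDiffAt_const.sub (contDiffAt_id.norm_sq ℝ)))
    exact contDiffAt_id.add (((hb'.neg.add (hd'.sqrt (hd x hx).ne')).div ha' (ha x hx).ne').smul hu)
  · intro x hx
    have h1 := hb x hx
    rw [mem_sphere_zero_iff_norm] at hx
    simp [s, d, hx, Real.sqrt_sq h1.le]
  · intro x hx
    have h1 := ha x hx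
    have h2 := Real.sq_sqrt (hd x hx).le
    have h3 : a x * s x = -b x + √(d x) := by simp only [s]; field_simp
    have h4 : ‖x + s x • (x - F x)‖ ^ 2 = 1 := by
      rw [norm_add_sq_real, inner_smul_right, norm_smul, mul_pow, Real.norm_eq_abs, sq_abs]
      change ‖x‖ ^ 2 + 2 * (s x * b x) + s x ^ 2 * a x = 1
      have h5 : a x * (‖x‖ ^ 2 + 2 * (s x * b x) + s x ^ 2 * a x) = a x * 1 := by
        have : (a x * s x + b x) ^ 2 = d x := by rw [h3, neg_add_cancel_comm, h2]
        simp only [d] at this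
        linarith
      exact mul_left_cancel₀ h1.ne' h5
    exact (pow_eq_one_iff_of_nonneg (norm_nonneg _) two_ne_zero).1 h4

open Metric Set in
theorem exists_fixedPoint_of_continuous_of_norm_le_one {E : Type*} [NormedAddCommGroup E]
    [InnerProductSpace ℝ E] [FiniteDimensional ℝ E] {f : E → E} (hf : Continuous f)
    (hle : ∀ x, ‖f x‖ ≤ 1) : ∃ x, f x = x := by
  by_contra! hne
  obtain ⟨z, -, hz⟩ := (isCompact_closedBall (0 : E) 1).exists_isMinOn
    ⟨0, by simp⟩ (f := fun x => ‖f x - x‖) (by fun_prop)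
  have hpos : 0 < ‖f z - z‖ := norm_pos_iff.2 (sub_ne_zero.2 (hne z))
  -- Half the least displacement on the ball: approximation and rescaling by 1 + ε each cost at most
  -- ε, the first strictly less.
  set ε := ‖f z - z‖ / 2 with hε
  have hε0 : 0 < ε := by positivity
  obtain ⟨g, hg, hgf, -⟩ := hf.exists_contDiff_approx 1 (continuous_const (y := ε)) fun _ => hε0
  have hg1 : ∀ x, ‖g x‖ ≤ 1 + ε := fun x => by
    have h1 := hgf x
    rw [dist_eq_norm] at h1
    have h2 := norm_le_norm_add_norm_sub' (g x) (f x)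
    linarith [hle x]
  obtain ⟨x, hx, hxg⟩ := exists_fixedPoint_closedBall_of_contDiff (F := fun x => (1 + ε)⁻¹ • g x)
    (by exact contDiff_const.smul hg) (fun x _ => by
      rw [norm_smul, norm_inv, Real.norm_of_nonneg (by positivity), inv_mul_le_iff₀ (by positivity),
        mul_one]
      exact hg1 x)
  have hgx : g x = (1 + ε) • x := by
    exact (inv_smul_eq_iff₀ (by positivity)).1 hxg
  have h1 : ‖f z - z‖ ≤ ‖f x - x‖ := hz hx
  have h2 : ‖f x - x‖ ≤ ‖f x - g x‖ + ‖g x - x‖ := norm_sub_le_norm_sub_add_norm_sub _ _ _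
  have h3 : ‖f x - g x‖ < ε := by rw [← dist_eq_norm, dist_comm]; exact hgf x
  have h4 : ‖g x - x‖ ≤ ε := by
    have : g x - x = ε • x := by rw [hgx]; module
    rw [this, norm_smul, Real.norm_of_nonneg hε0.le]
    exact mul_le_of_le_one_right hε0.le (mem_closedBall_zero_iff.1 hx)
  linarith

/-- **Brouwer fixed point theorem** for a continuous map with bounded range. -/
theorem exists_fixedPoint_of_continuous_of_norm_le {E : Type*} [NormedAddCommGroup E]
    [InnerProductSpace ℝ E] [FiniteDimensional ℝ E] {f : E → E} (hf : Continuous f) {R : ℝ}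
    (hle : ∀ x, ‖f x‖ ≤ R) : ∃ x, f x = x := by
  have hR : 0 < R + 1 := by linarith [(norm_nonneg _).trans (hle 0)]
  obtain ⟨x, hx⟩ := exists_fixedPoint_of_continuous_of_norm_le_one
    (f := fun x => (R + 1)⁻¹ • f ((R + 1) • x)) (by fun_prop) (fun x => by
      rw [norm_smul, norm_inv, Real.norm_of_nonneg hR.le, inv_mul_le_iff₀ hR]
      linarith [hle ((R + 1) • x)])
  exact ⟨(R + 1) • x, by rwa [inv_smul_eq_iff₀ hR.ne'] at hx⟩

/-! ### Projections and variational inequalities -/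

/-- Nearest point projection onto a closed convex set in a Hilbert space. -/
theorem exists_continuous_inner_sub_le_zero {E : Type*} [NormedAddCommGroup E]
    [InnerProductSpace ℝ E] {K : Set E} (hne : K.Nonempty) (hK : IsComplete K)
    (hconv : Convex ℝ K) : ∃ P : E → E, Continuous P ∧
      ∀ u, P u ∈ K ∧ ∀ w ∈ K, inner ℝ (u - P u) (w - P u) ≤ 0 := by
  choose P hPK hP using exists_norm_eq_iInf_of_complete_convex hne hK hconv
  have hP' : ∀ u, ∀ w ∈ K, inner ℝ (u - P u) (w - P u) ≤ 0 := fun u =>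
    (norm_eq_iInf_iff_real_inner_le_zero hconv (hPK u)).1 (hP u)
  refine ⟨P, ?_, fun u => ⟨hPK u, hP' u⟩⟩
  refine LipschitzWith.continuous (K := 1) (LipschitzWith.of_dist_le_mul fun u v => ?_)
  rw [dist_eq_norm, dist_eq_norm, NNReal.coe_one, one_mul]
  have h1 := hP' u (P v) (hPK v)
  have h2 := hP' v (P u) (hPK u)
  have h3 : ‖P u - P v‖ ^ 2 ≤ inner ℝ (u - v) (P u - P v) := by
    rw [← real_inner_self_eq_norm_sq]
    simp only [inner_sub_left, inner_sub_right] at *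
    linarith
  have h4 := real_inner_le_norm (u - v) (P u - P v)
  by_contra! h
  nlinarith [norm_nonneg (u - v), norm_nonneg (P u - P v)]

/-- **Hartman–Stampacchia theorem**: a continuous variational inequality on a nonempty compact
convex set has a solution. -/
theorem exists_forall_inner_sub_le_zero {E : Type*} [NormedAddCommGroup E]
    [InnerProductSpace ℝ E] [FiniteDimensional ℝ E] {K : Set E} (hne : K.Nonempty)
    (hK : IsCompact K) (hconv : Convex ℝ K) {G : E → E} (hG : Continuous G) :
    ∃ x ∈ K, ∀ y ∈ K, inner ℝ (G x) (y - x) ≤ 0 := by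
  obtain ⟨P, hPc, hP⟩ := exists_continuous_inner_sub_le_zero hne hK.isComplete hconv
  obtain ⟨R, hR⟩ := hK.isBounded.exists_norm_le
  -- At a fixed point, the obtuse-angle property of the projection is the required inequality.
  obtain ⟨x, hx⟩ := exists_fixedPoint_of_continuous_of_norm_le (f := fun x => P (x + G x))
    (by fun_prop) (fun x => hR _ (hP _).1)
  refine ⟨x, hx ▸ (hP _).1, fun y hy => ?_⟩
  have := (hP (x + G x)).2 y hy
  rwa [hx, add_sub_cancel_left] at this

/-! ### Equilibria and the multilinear program -/

namespace FiniteGame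

variable {n : ℕ} {S : Fin n → Type*} [∀ i, Fintype (S i)]

/-- The payoff of player `i` for the pure strategy `s` against the mixed strategies of the others. -/
def purePayoff (A : ∀ _ : Fin n, (∀ j, S j) → ℝ) (i : Fin n) (x : ∀ j, S j → ℝ) (s : S i) : ℝ :=
  ∑ t : Others S i, payoffAt A i s t * ∏ j : {j : Fin n // j ≠ i}, x j (t j)

theorem expectedPayoff_eq_sum_prod (A : ∀ _ : Fin n, (∀ j, S j) → ℝ) (i : Fin n)
    (x : ∀ j, S j → ℝ) : expectedPayoff A i x = ∑ st : S i × Others S i,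
      payoffAt A i st.1 st.2 * x i st.1 * ∏ j : {j : Fin n // j ≠ i}, x j (st.2 j) := by
  rw [expectedPayoff, ← (Equiv.piSplitAt i S).symm.sum_comp]
  refine Finset.sum_congr rfl fun st _ => ?_
  rw [payoffAt, mul_assoc, Fintype.prod_eq_mul_prod_subtype_ne _ i]
  congr 2
  · simp [Equiv.piSplitAt]
  · refine Finset.prod_congr rfl fun j _ => ?_
    simp [Equiv.piSplitAt, j.2]

theorem expectedPayoff_eq_sum_mul_purePayoff (A : ∀ _ : Fin n, (∀ j, S j) → ℝ) (i : Fin n)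
    (x : ∀ j, S j → ℝ) : expectedPayoff A i x = ∑ s, x i s * purePayoff A i x s := by
  rw [expectedPayoff_eq_sum_prod, Fintype.sum_prod_type]
  refine Finset.sum_congr rfl fun s _ => ?_
  rw [purePayoff, Finset.mul_sum]
  exact Finset.sum_congr rfl fun t _ => by ring

theorem purePayoff_update (A : ∀ _ : Fin n, (∀ j, S j) → ℝ) (i : Fin n)
    (x : ∀ j, S j → ℝ) (y : S i → ℝ) (s : S i) :
    purePayoff A i (Function.update x i y) s = purePayoff A i x s := by
  unfold purePayoff
  refine Finset.sum_congr rfl fun t _ => ?_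
  congr 1
  exact Finset.prod_congr rfl fun j _ => by rw [Function.update_of_ne j.2]

theorem expectedPayoff_update (A : ∀ _ : Fin n, (∀ j, S j) → ℝ) (i : Fin n)
    (x : ∀ j, S j → ℝ) (y : S i → ℝ) :
    expectedPayoff A i (Function.update x i y) = ∑ s, y s * purePayoff A i x s := by
  simp [expectedPayoff_eq_sum_mul_purePayoff, purePayoff_update]

theorem sum_mul_le_of_mem_stdSimplex {ι : Type*} [Fintype ι] {y u : ι → ℝ} {c : ℝ}
    (hy : y ∈ stdSimplex ℝ ι) (hu : ∀ s, u s ≤ c) : ∑ s, y s * u s ≤ c :=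
  calc ∑ s, y s * u s ≤ ∑ s, y s * c :=
        Finset.sum_le_sum fun s _ => mul_le_mul_of_nonneg_left (hu s) (hy.1 s)
    _ = c := by rw [← Finset.sum_mul, hy.2, one_mul]

/-- The payoff is linear in a player's own strategy, so pure deviations suffice. -/
theorem isNashEquilibrium_iff_purePayoff_le (A : ∀ _ : Fin n, (∀ j, S j) → ℝ)
    (x : ∀ j, S j → ℝ) : IsNashEquilibrium A x ↔
      (∀ i, x i ∈ stdSimplex ℝ (S i)) ∧ ∀ i s, purePayoff A i x s ≤ expectedPayoff A i x := by
  classical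
  refine and_congr_right fun _ => forall_congr' fun i => ⟨fun h s => ?_, fun h y hy => ?_⟩
  · have := h _ (single_mem_stdSimplex ℝ s)
    rw [expectedPayoff_update] at this
    simpa [Pi.single_apply] using this
  · rw [expectedPayoff_update]
    exact sum_mul_le_of_mem_stdSimplex hy h

theorem mlpObjective_eq (A : ∀ _ : Fin n, (∀ j, S j) → ℝ) (x : ∀ j, S j → ℝ) (p : Fin n → ℝ) :
    mlpObjective A x p = ∑ i, (expectedPayoff A i x - p i) := by
  simp only [mlpObjective, Finset.sum_sub_distrib, expectedPayoff_eq_sum_prod]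

theorem MLPFeasible.mem_stdSimplex {A : ∀ _ : Fin n, (∀ j, S j) → ℝ} {x : ∀ j, S j → ℝ}
    {p : Fin n → ℝ} (h : MLPFeasible A x p) (i : Fin n) : x i ∈ stdSimplex ℝ (S i) :=
  ⟨fun s => (h.bounds i s).1, h.sum_eq_one i⟩

theorem MLPFeasible.expectedPayoff_le {A : ∀ _ : Fin n, (∀ j, S j) → ℝ} {x : ∀ j, S j → ℝ}
    {p : Fin n → ℝ} (h : MLPFeasible A x p) (i : Fin n) : expectedPayoff A i x ≤ p i := by
  rw [expectedPayoff_eq_sum_mul_purePayoff]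
  exact sum_mul_le_of_mem_stdSimplex (h.mem_stdSimplex i) (h.payoff_le i)

theorem MLPFeasible.mlpObjective_nonpos {A : ∀ _ : Fin n, (∀ j, S j) → ℝ} {x : ∀ j, S j → ℝ}
    {p : Fin n → ℝ} (h : MLPFeasible A x p) : mlpObjective A x p ≤ 0 := by
  rw [mlpObjective_eq]
  exact Finset.sum_nonpos fun i _ => sub_nonpos.2 (h.expectedPayoff_le i)

theorem IsNashEquilibrium.mlpFeasible {A : ∀ _ : Fin n, (∀ j, S j) → ℝ} {x : ∀ j, S j → ℝ}
    (h : IsNashEquilibrium A x) : MLPFeasible A x fun i => expectedPayoff A i x where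
  payoff_le := ((isNashEquilibrium_iff_purePayoff_le A x).1 h).2
  sum_eq_one i := (h.1 i).2
  bounds i s := mem_Icc_of_mem_stdSimplex (h.1 i) s

theorem mlpObjective_expectedPayoff (A : ∀ _ : Fin n, (∀ j, S j) → ℝ) (x : ∀ j, S j → ℝ) :
    (mlpObjective A x fun i => expectedPayoff A i x) = 0 := by
  simp [mlpObjective_eq]

/-- **Nash's theorem**: every finite game has an equilibrium in mixed strategies. -/
theorem exists_isNashEquilibrium [∀ i, Nonempty (S i)] (A : ∀ _ : Fin n, (∀ j, S j) → ℝ) :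
    ∃ x, IsNashEquilibrium A x := by
  classical
  let toE : (∀ j, S j → ℝ) → EuclideanSpace ℝ (Σ i, S i) :=
    fun x => WithLp.toLp 2 fun q => x q.1 q.2
  let K : Set (EuclideanSpace ℝ (Σ i, S i)) := {z | ∀ i, (fun s => z ⟨i, s⟩) ∈ stdSimplex ℝ (S i)}
  have hKimage : K = toE '' Set.univ.pi fun i => stdSimplex ℝ (S i) := by
    ext z
    constructor
    · exact fun hz => ⟨fun i s => z ⟨i, s⟩, fun i _ => hz i, rfl⟩
    · rintro ⟨x, hx, rfl⟩ i
      exact hx i trivial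
  have hcont : Continuous toE := by fun_prop
  have hK : IsCompact K := by
    rw [hKimage]
    exact (isCompact_univ_pi fun i => isCompact_stdSimplex ℝ (S i)).image hcont
  have hne : K.Nonempty := by
    rw [hKimage]
    exact (Set.univ_pi_nonempty_iff.2 fun i =>
      ⟨_, single_mem_stdSimplex ℝ (Classical.arbitrary (S i))⟩).image _
  have hconv : Convex ℝ K := fun z hz w hw a b ha hb hab i =>
    convex_stdSimplex ℝ (S i) (hz i) (hw i) ha hb hab
  let G : EuclideanSpace ℝ (Σ i, S i) → EuclideanSpace ℝ (Σ i, S i) := fun z =>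
    WithLp.toLp 2 fun q => purePayoff A q.1 (fun j s => z ⟨j, s⟩) q.2
  have hG : Continuous G := by
    unfold G purePayoff
    fun_prop
  obtain ⟨z, hz, hvi⟩ := exists_forall_inner_sub_le_zero hne hK hconv hG
  refine ⟨fun i s => z ⟨i, s⟩, hz, fun i y hy => ?_⟩
  set x : ∀ j, S j → ℝ := fun i s => z ⟨i, s⟩ with hx
  -- Testing with a change in one player's block alone isolates that player's gain.
  have hmem : toE (Function.update x i y) ∈ K := by
    intro j
    rcases eq_or_ne j i with rfl | hj
    · simpa [toE] using hy
    · simpa [toE, Function.update_of_ne hj] using hz j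
  have h := hvi _ hmem
  have heq : inner ℝ (G z) (toE (Function.update x i y) - z) =
      ∑ s, (y s - x i s) * purePayoff A i x s := by
    rw [PiLp.inner_apply, Fintype.sum_sigma, Finset.sum_eq_single i]
    · simp [toE, G, hx]
    · intro j _ hj
      simp [toE, hx, Function.update_of_ne hj]
    · simp
  rw [heq] at h
  simp only [sub_mul, Finset.sum_sub_distrib] at h
  rw [expectedPayoff_update, expectedPayoff_eq_sum_mul_purePayoff]
  linarith

end FiniteGame

theorem theorem1 {n : ℕ} {S : Fin n → Type*} [∀ i, Fintype (S i)]
    (A : ∀ _ : Fin n, (∀ j, S j) → ℝ) (x : ∀ j, S j → ℝ) :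
    FiniteGame.IsNashEquilibrium A x ↔ ∃ p : Fin n → ℝ, FiniteGame.IsMLPOptimal A x p := by
  constructor
  · intro h
    refine ⟨_, h.mlpFeasible, fun x' p' h' => ?_⟩
    rw [FiniteGame.mlpObjective_expectedPayoff]
    exact h'.mlpObjective_nonpos
  · rintro ⟨p, hfeas, hopt⟩
    have hne : ∀ i, Nonempty (S i) := fun i => by
      by_contra hi
      rw [not_nonempty_iff] at hi
      simpa using hfeas.sum_eq_one i
    obtain ⟨z, hz⟩ := FiniteGame.exists_isNashEquilibrium A
    have h0 := hopt _ _ hz.mlpFeasible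
    rw [FiniteGame.mlpObjective_expectedPayoff, FiniteGame.mlpObjective_eq] at h0
    have hle : ∀ i, FiniteGame.expectedPayoff A i x - p i ≤ 0 := fun i =>
      sub_nonpos.2 (hfeas.expectedPayoff_le i)
    -- Comparison with the equilibrium `z` forces a sum of nonpositive gaps to be 0, so each gap is
    -- 0.
    have heq := (Finset.sum_eq_zero_iff_of_nonpos fun i _ => hle i).1
      (le_antisymm (Finset.sum_nonpos fun i _ => hle i) h0)
    refine (FiniteGame.isNashEquilibrium_iff_purePayoff_le A x).2
      ⟨hfeas.mem_stdSimplex, fun i s => ?_⟩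
    rw [sub_eq_zero.1 (heq i (Finset.mem_univ i))]
    exact hfeas.payoff_le i s
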